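/- Let $k$ be a field and let $\mathsf E$ be a small $k$-linear category. Write $x\preceq y$ if there are $n\ge 1$ and objects $x=z_0,z_1,\dots,z_n=y$ of $\mathsf E$ with $\operatorname{Hom}_{\mathsf E}(z_{i-1},z_i)\neq 0$ for all $1\le i\le n$, and write $x\prec y$ if $x\preceq y$ and $y\not\preceq x$. Assume that $\mathsf E$ is left strictly locally finite, that is: (i) $\operatorname{Hom}_{\mathsf E}(x,y)$ is finite-dimensional for all objects $x,y$; (ii) the set $\{z\in\mathsf E\mid x\preceq z\preceq y\}$ is finite for all objects $x,y$; (iii) for every object $y$ there is a finite set $X_y$ of objects with $x\prec y$ for all $x\in X_y$ such that every morphism $f\colon z\to y$ with $z\prec y$ is a finite sum $f=\sum_{i=1}^n h_ig_i$ with $g_i\colon z\to x_i$, $h_i\colon x_i\to y$, $x_i\in X_y$, $n\ge 0$. Let $\mathcal C_{\mathsf E}=\bigoplus_{x,y\in\mathsf E}\operatorname{Hom}_{\mathsf E}(x,y)^*$ be the coalgebra over $k$ whose comultiplication maps $\operatorname{Hom}_{\mathsf E}(x,y)^*$ to $\bigoplus_{x\preceq z\preceq y}\operatorname{Hom}_{\mathsf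 E}(x,z)^*\otimes_k\operatorname{Hom}_{\mathsf E}(z,y)^*$ by the duals of the composition maps, and whose counit is the evaluation at $\mathrm{id}_x$ on $\operatorname{Hom}_{\mathsf E}(x,x)^*$ and vanishes on $\operatorname{Hom}_{\mathsf E}(x,y)^*$ for $x\ne y$. A left $\mathcal C_{\mathsf E}$-contramodule is a $k$-vector space $\mathfrak P$ with a $k$-linear map $\pi\colon\operatorname{Hom}_k(\mathcal C_{\mathsf E},\mathfrak P)\to\mathfrak P$ satisfying the contraassociativity and contraunitality axioms of left contramodules, where $\operatorname{Hom}_k(\mathcal C_{\mathsf E},\operatorname{Hom}_k(\mathcal C_{\mathsf E},\mathfrak P))$ is identified with $\operatorname{Hom}_k(\mathcal C_{\mathsf E}\otimes_k\mathcal C_{\mathsf E},\mathfrak P)$ by $F\mapsto(u\otimes v\mapsto F(v)(u))$. A left $\mathsf E$-module is a covariant $k$-linear functor $\mathsf E\to k\text{-}\mathrm{Vect}$; it is locally finite if all its values are finite-dimensional. For a left $\mathcal C_{\mathsf E}$-contramodule $\mathfrak P$, a morphism $f\colon x\to y$ in $\mathsf E$ and $p\in\mathfrak P$, let $f\cdot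 p\in\mathfrak P$ be the image under $\pi$ of the linear map $\mathcal C_{\mathsf E}\to\mathfrak P$ that takes $\varphi\in\operatorname{Hom}_{\mathsf E}(x,y)^*$ to $\varphi(f)p$ and vanishes on all the other direct summands. The left $\mathsf E$-module $\Theta_{\mathsf E}(\mathfrak P)$ has the values $\Theta_{\mathsf E}(\mathfrak P)(x)=\mathrm{id}_x\cdot\mathfrak P$, on which morphisms act by $p\mapsto f\cdot p$. The contramodule $\mathfrak P$ is called locally finite if $\Theta_{\mathsf E}(\mathfrak P)$ is locally finite. Then the class of all left $\mathsf E$-modules isomorphic to $\Theta_{\mathsf E}(\mathfrak P)$ for some locally finite left $\mathcal C_{\mathsf E}$-contramodule $\mathfrak P$ is closed under extensions both in the abelian category of left $\mathsf E$-modules and in the abelian category of locally finite left $\mathsf E$-modules: if $0\to M'\to M\to M''\to 0$ is a short exact sequence in one of these categories and $M'$ and $M''$ belong to the class, then so does $M$. -/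

import Mathlib

open CategoryTheory
open scoped TensorProduct DirectSum

universe uk u v w

noncomputable section

namespace LinCat

section Preorder

variable (k : Type uk) (E : Type u) [Field k] [Category.{v} E] [Preadditive E] [Linear k E]

/-- `x ⪯ y`: there are `n ≥ 1` and objects `x = z₀, z₁, …, zₙ = y` with `Hom(zᵢ₋₁, zᵢ) ≠ 0`
for all `1 ≤ i ≤ n`. -/
def Prec {E : Type u} [Category.{v} E] [Preadditive E] (x y : E) : Prop :=
  Relation.TransGen (fun a b : E => ∃ f : a ⟶ b, f ≠ 0) x y

/-- `x ≺ y`: `x ⪯ y` and not `y ⪯ x`. -/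
def StrictPrec {E : Type u} [Category.{v} E] [Preadditive E] (x y : E) : Prop :=
  Prec x y ∧ ¬ Prec y x

/-- A `k`-linear category is locally finite if its spaces of morphisms are finite-dimensional and
all the intervals of the preorder `⪯` on the set of objects are finite. -/
class IsLocallyFinite : Prop where
  finite_hom : ∀ x y : E, FiniteDimensional k (x ⟶ y)
  finite_interval : ∀ x y : E, {z : E | Prec x z ∧ Prec z y}.Finite

/-- A locally finite `k`-linear category is left strictly locally finite if for every object `y`
there is a finite set `X` of objects `x ≺ y` such that every morphism `z ⟶ y` with `z ≺ y` is a
finite sum of morphisms that factor through objects of `X`. -/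
class IsLeftStrictlyLocallyFinite : Prop extends IsLocallyFinite k E where
  exists_frontier : ∀ y : E, ∃ X : Set E, X.Finite ∧ (∀ x ∈ X, StrictPrec x y) ∧
    ∀ (z : E) (f : z ⟶ y), StrictPrec z y →
      ∃ (n : ℕ) (x : Fin n → E) (g : ∀ i, z ⟶ x i) (h : ∀ i, x i ⟶ y),
        (∀ i, x i ∈ X) ∧ f = ∑ i, g i ≫ h i

attribute [instance] IsLocallyFinite.finite_hom

end Preorder

section Coalg

variable (k : Type uk) (E : Type u) [Field k] [Category.{v} E] [Preadditive E] [Linear k E]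

/-- The underlying vector space `⨁_{x, y} Hom(x, y)^*` of the coalgebra of a locally finite
`k`-linear category. -/
def Coalg : Type (max u v uk) := ⨁ p : E × E, Module.Dual k (p.1 ⟶ p.2)

instance : AddCommGroup (Coalg k E) :=
  inferInstanceAs (AddCommGroup (⨁ p : E × E, Module.Dual k (p.1 ⟶ p.2)))

instance : Module k (Coalg k E) :=
  inferInstanceAs (Module k (⨁ p : E × E, Module.Dual k (p.1 ⟶ p.2)))

variable {E}

open scoped Classical in
/-- The inclusion of the direct summand `Hom(x, y)^*`. -/
def incl (x y : E) : Module.Dual k (x ⟶ y) →ₗ[k] Coalg k E :=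
  DirectSum.lof k (E × E) (fun p => Module.Dual k (p.1 ⟶ p.2)) (x, y)

variable {k} in
open scoped Classical in
/-- The linear map from the direct sum with prescribed restrictions to the summands. -/
def desc {V : Type*} [AddCommGroup V] [Module k V]
    (F : ∀ x y : E, Module.Dual k (x ⟶ y) →ₗ[k] V) : Coalg k E →ₗ[k] V :=
  DirectSum.toModule k (E × E) V (fun p => F p.1 p.2)

/-- The projection onto the direct summand `Hom(x, y)^*`. -/
def proj (x y : E) : Coalg k E →ₗ[k] Module.Dual k (x ⟶ y) :=
  DirectSum.component k (E × E) (fun p => Module.Dual k (p.1 ⟶ p.2)) (x, y)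

/-- The linear function on the coalgebra given by a morphism `f : x ⟶ y`: the projection onto the
summand `Hom(x, y)^*`, followed by the evaluation at `f`. -/
def ev {x y : E} (f : x ⟶ y) : Coalg k E →ₗ[k] k :=
  Module.Dual.eval k (x ⟶ y) f ∘ₗ proj k x y

variable {k}

@[simp]
lemma desc_incl {V : Type*} [AddCommGroup V] [Module k V]
    (F : ∀ x y : E, Module.Dual k (x ⟶ y) →ₗ[k] V) (x y : E) (φ : Module.Dual k (x ⟶ y)) :
    desc F (incl k x y φ) = F x y φ := by
  classical
  exact DirectSum.toModule_lof (M := fun p : E × E => Module.Dual k (p.1 ⟶ p.2)) k (x, y) φ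

lemma Coalg.hom_ext {V : Type*} [AddCommGroup V] [Module k V] {F G : Coalg k E →ₗ[k] V}
    (h : ∀ (x y : E) (φ : Module.Dual k (x ⟶ y)), F (incl k x y φ) = G (incl k x y φ)) :
    F = G := by
  classical
  refine DirectSum.linearMap_ext k fun p => LinearMap.ext fun φ => ?_
  exact h p.1 p.2 φ

lemma proj_incl_self (x y : E) (φ : Module.Dual k (x ⟶ y)) :
    proj k x y (incl k x y φ) = φ := by
  classical
  exact DirectSum.component.lof_self (M := fun p : E × E => Module.Dual k (p.1 ⟶ p.2)) k (x, y) φ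

lemma proj_incl_of_ne {x y x' y' : E} (φ : Module.Dual k (x' ⟶ y'))
    (h : ¬ (x' = x ∧ y' = y)) : proj k x y (incl k x' y' φ) = 0 := by
  classical
  exact (DirectSum.component.of (M := fun p : E × E => Module.Dual k (p.1 ⟶ p.2)) k (x, y)
    (x', y') φ).trans (dif_neg (by simpa [Prod.ext_iff] using h))

@[simp]
lemma ev_incl_self {x y : E} (f : x ⟶ y) (φ : Module.Dual k (x ⟶ y)) :
    ev k f (incl k x y φ) = φ f := by
  simp [ev, proj_incl_self]

lemma ev_incl_of_ne {x y x' y' : E} (f : x ⟶ y) (φ : Module.Dual k (x' ⟶ y'))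
    (h : ¬ (x' = x ∧ y' = y)) : ev k f (incl k x' y' φ) = 0 := by
  simp [ev, proj_incl_of_ne φ h]

variable (k)

lemma ev_add {x y : E} (f g : x ⟶ y) : ev k (f + g) = ev k f + ev k g := by
  simp only [ev, map_add, LinearMap.add_comp]

lemma ev_smul {x y : E} (r : k) (f : x ⟶ y) : ev k (r • f) = r • ev k f := by
  simp only [ev, map_smul, LinearMap.smul_comp]

lemma prec_of_ne_zero {x y : E} {f : x ⟶ y} (h : f ≠ 0) : Prec x y :=
  Relation.TransGen.single ⟨f, h⟩

lemma ev_tmul_ev_map {x z y : E} (f : x ⟶ z) (g : z ⟶ y)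
    (t : Module.Dual k (x ⟶ z) ⊗[k] Module.Dual k (z ⟶ y)) :
    TensorProduct.dualDistrib k _ _ (ev k f ⊗ₜ ev k g)
      (TensorProduct.map (incl k x z) (incl k z y) t) =
    TensorProduct.dualDistrib k _ _ t (f ⊗ₜ g) := by
  induction t with
  | zero => simp
  | add a b ha hb => simp only [map_add, ha, hb, LinearMap.add_apply]
  | tmul a b => simp

lemma ev_tmul_ev_map_of_ne {x z z' y x' w y' : E} (f : x ⟶ z) (g : z' ⟶ y)
    (t : Module.Dual k (x' ⟶ w) ⊗[k] Module.Dual k (w ⟶ y'))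
    (h : ¬ (x' = x ∧ w = z ∧ w = z' ∧ y' = y)) :
    TensorProduct.dualDistrib k _ _ (ev k f ⊗ₜ ev k g)
      (TensorProduct.map (incl k x' w) (incl k w y') t) = 0 := by
  induction t with
  | zero => simp
  | add a b ha hb => simp only [map_add, ha, hb, add_zero]
  | tmul a b =>
    rw [TensorProduct.map_tmul, TensorProduct.dualDistrib_apply]
    by_cases h1 : x' = x ∧ w = z
    · rw [ev_incl_of_ne g b (by tauto), mul_zero]
    · rw [ev_incl_of_ne f a h1, zero_mul]

variable [IsLocallyFinite k E]

/-- The component `Hom(x, y)^* ⟶ Hom(x, z)^* ⊗ Hom(z, y)^*` of the comultiplication, dual to the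
composition map `Hom(x, z) ⊗ Hom(z, y) ⟶ Hom(x, y)`. -/
def comulComponent (x z y : E) :
    Module.Dual k (x ⟶ y) →ₗ[k] Module.Dual k (x ⟶ z) ⊗[k] Module.Dual k (z ⟶ y) :=
  (TensorProduct.dualDistribEquiv k (x ⟶ z) (z ⟶ y)).symm.toLinearMap ∘ₗ
    (TensorProduct.lift (Linear.comp (S := k) x z y)).dualMap

variable (E) in
/-- The finite set of all `z` with `x ⪯ z ⪯ y`. -/
def interval (x y : E) : Finset E :=
  (IsLocallyFinite.finite_interval (k := k) x y).toFinset

instance : CoalgebraStruct k (Coalg k E) where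
  comul := desc fun x y => ∑ z ∈ interval k E x y,
    TensorProduct.map (incl k x z) (incl k z y) ∘ₗ comulComponent k x z y
  counit := desc fun x y => by
    classical
    exact if h : x = y then Module.Dual.eval k (x ⟶ y) (eqToHom h) else 0

lemma comul_incl (x y : E) (φ : Module.Dual k (x ⟶ y)) :
    CoalgebraStruct.comul (R := k) (incl k x y φ) = ∑ z ∈ interval k E x y,
      TensorProduct.map (incl k x z) (incl k z y) (comulComponent k x z y φ) := by
  simp [CoalgebraStruct.comul]

lemma counit_incl_self (x : E) (φ : Module.Dual k (x ⟶ x)) :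
    CoalgebraStruct.counit (R := k) (incl k x x φ) = φ (𝟙 x) := by
  simp [CoalgebraStruct.counit]

lemma counit_incl_of_ne {x y : E} (h : x ≠ y) (φ : Module.Dual k (x ⟶ y)) :
    CoalgebraStruct.counit (R := k) (incl k x y φ) = 0 := by
  simp [CoalgebraStruct.counit, h]

lemma dualDistrib_comulComponent (x z y : E) (φ : Module.Dual k (x ⟶ y))
    (f : x ⟶ z) (g : z ⟶ y) :
    TensorProduct.dualDistrib k _ _ (comulComponent k x z y φ) (f ⊗ₜ g) = φ (f ≫ g) := by
  have h : TensorProduct.dualDistrib k (x ⟶ z) (z ⟶ y) (comulComponent k x z y φ) =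
      (TensorProduct.lift (Linear.comp (S := k) x z y)).dualMap φ :=
    (TensorProduct.dualDistribEquiv k (x ⟶ z) (z ⟶ y)).apply_symm_apply _
  rw [h]
  rfl

/-- The multiplication on linear functions that is dual to the comultiplication extends the
composition of morphisms. -/
lemma ev_tmul_ev_comp_comul {x z y : E} (f : x ⟶ z) (g : z ⟶ y) :
    TensorProduct.dualDistrib k _ _ (ev k f ⊗ₜ ev k g) ∘ₗ CoalgebraStruct.comul =
      ev k (f ≫ g) := by
  refine Coalg.hom_ext fun x' y' φ => ?_
  rw [LinearMap.comp_apply, comul_incl, map_sum]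
  by_cases hxy : x' = x ∧ y' = y
  · obtain ⟨rfl, rfl⟩ := hxy
    rw [Finset.sum_eq_single z]
    · rw [ev_tmul_ev_map, dualDistrib_comulComponent, ev_incl_self]
    · intro w _ hw
      exact ev_tmul_ev_map_of_ne k f g _ (by tauto)
    · intro hz
      rw [ev_tmul_ev_map, dualDistrib_comulComponent]
      by_cases hf : f = 0
      · simp [hf]
      by_cases hg : g = 0
      · simp [hg]
      · refine absurd ?_ hz
        rw [interval, Set.Finite.mem_toFinset]
        exact ⟨prec_of_ne_zero hf, prec_of_ne_zero hg⟩
  · rw [ev_incl_of_ne _ _ hxy]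
    exact Finset.sum_eq_zero fun w _ => ev_tmul_ev_map_of_ne k f g _ (by tauto)

lemma ev_tmul_ev_comp_comul_of_ne {x z z' y : E} (f : x ⟶ z) (g : z' ⟶ y) (h : z ≠ z') :
    TensorProduct.dualDistrib k _ _ (ev k f ⊗ₜ ev k g) ∘ₗ CoalgebraStruct.comul = 0 := by
  refine Coalg.hom_ext fun x' y' φ => ?_
  rw [LinearMap.comp_apply, comul_incl, map_sum]
  refine Finset.sum_eq_zero fun w _ => ev_tmul_ev_map_of_ne k f g _ ?_
  rintro ⟨-, h1, h2, -⟩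
  exact h (h1.symm.trans h2)

variable (E) in
/-- A basis of the coalgebra whose coordinate functions are given by morphisms. -/
lemma exists_basis : ∃ (ι : Type (max u v)) (B : Module.Basis ι k (Coalg k E))
    (s t : ι → E) (m : ∀ i, s i ⟶ t i), ∀ i, B.coord i = ev k (m i) := by
  classical
  let b := fun p : E × E => Module.Free.chooseBasis k (p.1 ⟶ p.2)
  let B : Module.Basis (Σ p : E × E, Module.Free.ChooseBasisIndex k (p.1 ⟶ p.2)) k (Coalg k E) :=
    DFinsupp.basis (fun p : E × E => (b p).dualBasis)
  refine ⟨_, B, fun i => i.1.1, fun i => i.1.2, fun i => b i.1 i.2, fun i => ?_⟩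
  refine LinearMap.ext fun c => ?_
  exact (b i.1).dualBasis_repr (proj k i.1.1 i.1.2 c) i.2

lemma dualDistrib_assoc_rTensor {C : Type*} [AddCommGroup C] [Module k C]
    (μ : C →ₗ[k] C ⊗[k] C) (a b c : Module.Dual k C) (t : C ⊗[k] C) :
    TensorProduct.dualDistrib k _ _ (a ⊗ₜ TensorProduct.dualDistrib k _ _ (b ⊗ₜ c))
      (TensorProduct.assoc k C C C (μ.rTensor C t)) =
    TensorProduct.dualDistrib k _ _
      ((TensorProduct.dualDistrib k _ _ (a ⊗ₜ b) ∘ₗ μ) ⊗ₜ c) t := by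
  induction t with
  | zero => simp
  | add p q hp hq => simp only [map_add, hp, hq]
  | tmul p q =>
    rw [LinearMap.rTensor_tmul, TensorProduct.dualDistrib_apply, LinearMap.comp_apply]
    induction μ p with
    | zero => simp
    | add p q hp hq => simp only [TensorProduct.add_tmul, map_add, hp, hq, add_mul]
    | tmul p q => simp [mul_assoc]

lemma dualDistrib_lTensor {C : Type*} [AddCommGroup C] [Module k C]
    (μ : C →ₗ[k] C ⊗[k] C) (a b c : Module.Dual k C) (t : C ⊗[k] C) :
    TensorProduct.dualDistrib k _ _ (a ⊗ₜ TensorProduct.dualDistrib k _ _ (b ⊗ₜ c))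
      (μ.lTensor C t) =
    TensorProduct.dualDistrib k _ _
      (a ⊗ₜ (TensorProduct.dualDistrib k _ _ (b ⊗ₜ c) ∘ₗ μ)) t := by
  induction t with
  | zero => simp
  | add p q hp hq => simp only [map_add, hp, hq]
  | tmul p q => simp

lemma coord_tensorProduct {C D ι κ : Type*} [AddCommGroup C] [Module k C] [AddCommGroup D]
    [Module k D] (B : Module.Basis ι k C) (B' : Module.Basis κ k D) (i : ι) (j : κ) :
    (B.tensorProduct B').coord (i, j) =
      TensorProduct.dualDistrib k C D (B.coord i ⊗ₜ B'.coord j) := by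
  refine TensorProduct.ext' fun c d => ?_
  simp [mul_comm]

lemma counit_incl_eq_ev_left (x w : E) (φ : Module.Dual k (x ⟶ w)) :
    CoalgebraStruct.counit (R := k) (incl k x w φ) = ev k (𝟙 w) (incl k x w φ) := by
  by_cases h : x = w
  · subst h
    rw [counit_incl_self, ev_incl_self]
  · rw [counit_incl_of_ne k h, ev_incl_of_ne _ _ (by tauto)]

lemma counit_incl_eq_ev_right (x w : E) (φ : Module.Dual k (x ⟶ w)) :
    CoalgebraStruct.counit (R := k) (incl k x w φ) = ev k (𝟙 x) (incl k x w φ) := by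
  by_cases h : x = w
  · subst h
    rw [counit_incl_self, ev_incl_self]
  · rw [counit_incl_of_ne k h, ev_incl_of_ne _ _ (by tauto)]

lemma counit_tmul_ev_comp_comul {x y : E} (f : x ⟶ y) :
    TensorProduct.dualDistrib k _ _ (CoalgebraStruct.counit ⊗ₜ ev k f) ∘ₗ CoalgebraStruct.comul =
      ev k f := by
  have h := ev_tmul_ev_comp_comul k (𝟙 x) f
  rw [Category.id_comp] at h
  refine Eq.trans (Coalg.hom_ext fun x' y' φ => ?_) h
  rw [LinearMap.comp_apply, LinearMap.comp_apply, comul_incl, map_sum, map_sum]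
  refine Finset.sum_congr rfl fun w _ => ?_
  induction comulComponent k x' w y' φ with
  | zero => simp
  | add p q hp hq => simp only [map_add, hp, hq]
  | tmul p q =>
    rw [TensorProduct.map_tmul, TensorProduct.dualDistrib_apply, TensorProduct.dualDistrib_apply]
    by_cases hw : w = x
    · subst hw
      rw [counit_incl_eq_ev_left]
    · rw [ev_incl_of_ne f q (by tauto), mul_zero, mul_zero]

lemma ev_tmul_counit_comp_comul {x y : E} (f : x ⟶ y) :
    TensorProduct.dualDistrib k _ _ (ev k f ⊗ₜ CoalgebraStruct.counit) ∘ₗ CoalgebraStruct.comul =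
      ev k f := by
  have h := ev_tmul_ev_comp_comul k f (𝟙 y)
  rw [Category.comp_id] at h
  refine Eq.trans (Coalg.hom_ext fun x' y' φ => ?_) h
  rw [LinearMap.comp_apply, LinearMap.comp_apply, comul_incl, map_sum, map_sum]
  refine Finset.sum_congr rfl fun w _ => ?_
  induction comulComponent k x' w y' φ with
  | zero => simp
  | add p q hp hq => simp only [map_add, hp, hq]
  | tmul p q =>
    rw [TensorProduct.map_tmul, TensorProduct.dualDistrib_apply, TensorProduct.dualDistrib_apply]
    by_cases hw : w = y
    · subst hw
      rw [counit_incl_eq_ev_right]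
    · rw [ev_incl_of_ne f p (by tauto), zero_mul, zero_mul]

instance : Coalgebra k (Coalg k E) where
  coassoc := by
    obtain ⟨ι, B, s, t, m, hB⟩ := exists_basis k E
    refine LinearMap.ext fun c => ?_
    refine Module.Basis.ext_elem (B.tensorProduct (B.tensorProduct B)) ?_
    rintro ⟨i, j, l⟩
    change (B.tensorProduct (B.tensorProduct B)).coord (i, j, l) _ =
      (B.tensorProduct (B.tensorProduct B)).coord (i, j, l) _
    rw [coord_tensorProduct, coord_tensorProduct]
    simp only [LinearMap.comp_apply, LinearEquiv.coe_coe]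
    rw [dualDistrib_assoc_rTensor, dualDistrib_lTensor, hB, hB, hB]
    generalize m i = f
    generalize m j = g
    generalize m l = h
    by_cases h1 : t i = s j
    · by_cases h2 : t j = s l
      · generalize s i = x at f
        generalize t l = y at h
        generalize t i = z at f h1
        generalize s j = z' at g h1
        generalize t j = w at g h2
        generalize s l = w' at h h2
        subst h1 h2
        have e1 := LinearMap.congr_fun (ev_tmul_ev_comp_comul k (f ≫ g) h) c
        have e2 := LinearMap.congr_fun (ev_tmul_ev_comp_comul k f (g ≫ h)) c
        rw [ev_tmul_ev_comp_comul, ev_tmul_ev_comp_comul]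
        rw [LinearMap.comp_apply] at e1 e2
        rw [e1, e2, Category.assoc]
      · rw [ev_tmul_ev_comp_comul_of_ne k g h h2]
        generalize s i = x at f
        generalize t i = z at f h1
        generalize s j = z' at g h1
        subst h1
        have e1 := LinearMap.congr_fun (ev_tmul_ev_comp_comul_of_ne k (f ≫ g) h h2) c
        rw [ev_tmul_ev_comp_comul]
        rw [LinearMap.comp_apply] at e1
        rw [e1]
        simp
    · rw [ev_tmul_ev_comp_comul_of_ne k f g h1]
      by_cases h2 : t j = s l
      · generalize t l = y at h
        generalize t j = w at g h2
        generalize s l = w' at h h2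
        subst h2
        have e2 := LinearMap.congr_fun (ev_tmul_ev_comp_comul_of_ne k f (g ≫ h) h1) c
        rw [ev_tmul_ev_comp_comul]
        rw [LinearMap.comp_apply] at e2
        rw [e2]
        simp
      · rw [ev_tmul_ev_comp_comul_of_ne k g h h2]
        simp
  rTensor_counit_comp_comul := by
    obtain ⟨ι, B, s, t, m, hB⟩ := exists_basis k E
    refine LinearMap.ext fun c => (TensorProduct.lid k (Coalg k E)).injective ?_
    refine Module.Basis.ext_elem B fun i => ?_
    change B.coord i _ = B.coord i _
    have h : ∀ d : Coalg k E ⊗[k] Coalg k E,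
        B.coord i (TensorProduct.lid k _ (CoalgebraStruct.counit.rTensor _ d)) =
          TensorProduct.dualDistrib k _ _ (CoalgebraStruct.counit ⊗ₜ B.coord i) d := fun d => by
      induction d with
      | zero => simp
      | add p q hp hq => simp only [map_add, hp, hq]
      | tmul p q => simp
    have e := LinearMap.congr_fun (counit_tmul_ev_comp_comul k (m i)) c
    rw [LinearMap.comp_apply] at e ⊢
    rw [h, hB, e]
    simp
  lTensor_counit_comp_comul := by
    obtain ⟨ι, B, s, t, m, hB⟩ := exists_basis k E
    refine LinearMap.ext fun c => (TensorProduct.rid k (Coalg k E)).injective ?_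
    refine Module.Basis.ext_elem B fun i => ?_
    change B.coord i _ = B.coord i _
    have h : ∀ d : Coalg k E ⊗[k] Coalg k E,
        B.coord i (TensorProduct.rid k _ (CoalgebraStruct.counit.lTensor _ d)) =
          TensorProduct.dualDistrib k _ _ (B.coord i ⊗ₜ CoalgebraStruct.counit) d := fun d => by
      induction d with
      | zero => simp
      | add p q hp hq => simp only [map_add, hp, hq]
      | tmul p q => simp [mul_comm]
    have e := LinearMap.congr_fun (ev_tmul_counit_comp_comul k (m i)) c
    rw [LinearMap.comp_apply] at e ⊢
    rw [h, hB, e]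
    simp

end Coalg

section Contra

/-- A left contramodule over a coalgebra `C` over a field `k`: a vector space `P` with a linear
contraaction map `π : Hom(C, P) ⟶ P` that is contraassociative and contraunital. The identification
of `Hom(C, Hom(C, P))` with `Hom(C ⊗ C, P)` sends `F` to the map `u ⊗ v ↦ F v u`. -/
structure LeftContramodule (k : Type uk) (C : Type u) [Field k] [AddCommGroup C] [Module k C]
    [Coalgebra k C] where
  carrier : Type w
  [addCommGroup : AddCommGroup carrier]
  [module : Module k carrier]
  contraaction : (C →ₗ[k] carrier) →ₗ[k] carrier
  contraassoc : ∀ F : C →ₗ[k] C →ₗ[k] carrier,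
    contraaction (TensorProduct.lift F.flip ∘ₗ CoalgebraStruct.comul) =
      contraaction (contraaction ∘ₗ F)
  contraunit : ∀ p : carrier, contraaction (CoalgebraStruct.counit.smulRight p) = p

attribute [instance] LeftContramodule.addCommGroup LeftContramodule.module

variable {k : Type uk} {E : Type u} [Field k] [Category.{v} E] [Preadditive E] [Linear k E]
variable [IsLocallyFinite k E]

namespace LeftContramodule

/-- The action of a linear function `a` on the coalgebra in a left contramodule. -/
def act {C : Type*} [AddCommGroup C] [Module k C] [Coalgebra k C]
    (P : LeftContramodule.{uk, _, w} k C) : Module.Dual k C →ₗ[k] P.carrier →ₗ[k] P.carrier :=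
  LinearMap.compr₂ (LinearMap.smulRightₗ (R := k) (M := P.carrier) (M₂ := C)) P.contraaction

lemma act_apply {C : Type*} [AddCommGroup C] [Module k C] [Coalgebra k C]
    (P : LeftContramodule.{uk, _, w} k C) (a : Module.Dual k C) (p : P.carrier) :
    P.act a p = P.contraaction (a.smulRight p) := rfl

lemma act_act {C : Type*} [AddCommGroup C] [Module k C] [Coalgebra k C]
    (P : LeftContramodule.{uk, _, w} k C) (a b : Module.Dual k C) (p : P.carrier) :
    P.act b (P.act a p) =
      P.act (TensorProduct.dualDistrib k C C (a ⊗ₜ b) ∘ₗ CoalgebraStruct.comul) p := by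
  have h := P.contraassoc (b.smulRight (a.smulRight p))
  have h1 : P.contraaction ∘ₗ b.smulRight (a.smulRight p) = b.smulRight (P.act a p) := by
    ext c
    simp [act_apply]
  have h2 : TensorProduct.lift (b.smulRight (a.smulRight p)).flip =
      (TensorProduct.dualDistrib k C C (a ⊗ₜ b)).smulRight p := by
    refine TensorProduct.ext' fun c d => ?_
    simp [smul_smul, mul_comm]
  rw [h1, h2] at h
  exact h.symm

lemma act_ev_act_ev (P : LeftContramodule.{uk, _, w} k (Coalg k E)) {x y z : E} (f : x ⟶ y)
    (g : y ⟶ z) (p : P.carrier) : P.act (ev k g) (P.act (ev k f) p) = P.act (ev k (f ≫ g)) p := by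
  rw [act_act, ev_tmul_ev_comp_comul]

/-- The vector space `P^x`: the image of the idempotent operator on a left contramodule `P` that is
given by the action of the linear function `ev (𝟙 x)`. -/
def component (P : LeftContramodule.{uk, _, w} k (Coalg k E)) (x : E) : Submodule k P.carrier :=
  LinearMap.range (P.act (ev k (𝟙 x)))

/-- The action map `P^x ⟶ P^y` of a morphism `f : x ⟶ y`: it sends `p` to the image under the
contraaction of the map `Coalg k E ⟶ P` that vanishes outside of `Hom(x, y)^*` and takes
`φ ∈ Hom(x, y)^*` to `φ(f) p`. -/
def componentMap (P : LeftContramodule.{uk, _, w} k (Coalg k E)) {x y : E} (f : x ⟶ y) :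
    P.component x →ₗ[k] P.component y :=
  (P.act (ev k f)).restrict fun p _ =>
    ⟨P.act (ev k f) p, by rw [act_ev_act_ev, Category.comp_id]⟩

end LeftContramodule

variable (k E)

/-- The property of being `k`-linear, for functors to the category of `k`-vector spaces. -/
def isLeftModule : ObjectProperty (E ⥤ ModuleCat.{w} k) :=
  fun M => M.Additive ∧ M.Linear k

/-- The category of left modules over a `k`-linear category: covariant `k`-linear functors to the
category of `k`-vector spaces. -/
abbrev LeftMod := (isLeftModule.{uk, u, v, w} k E).FullSubcategory

/-- A left module is locally finite if it takes values in finite-dimensional vector spaces. -/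
def isLocallyFiniteModule : ObjectProperty (LeftMod.{uk, u, v, w} k E) :=
  fun M => ∀ x : E, FiniteDimensional k (M.obj.obj x)

/-- The category of locally finite left modules. -/
abbrev LocFinLeftMod := (isLocallyFiniteModule.{uk, u, v, w} k E).FullSubcategory

variable {k E}

/-- The left module underlying a left contramodule over the coalgebra of a locally finite
`k`-linear category. -/
def theta (P : LeftContramodule.{uk, _, w} k (Coalg k E)) : LeftMod.{uk, u, v, w} k E where
  obj :=
    { obj := fun x => ModuleCat.of k (P.component x)
      map := fun f => ModuleCat.ofHom (P.componentMap f)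
      map_id := fun x => by
        ext ⟨p, q, rfl⟩
        change P.act (ev k (𝟙 x)) (P.act (ev k (𝟙 x)) q) = P.act (ev k (𝟙 x)) q
        rw [LeftContramodule.act_ev_act_ev, Category.comp_id]
      map_comp := fun f g => by
        ext p
        exact (P.act_ev_act_ev f g p.1).symm }
  property := by
    refine ⟨⟨fun {x y f g} => ?_⟩, ⟨fun {x y} f r => ?_⟩⟩
    · ext p
      change P.act (ev k (f + g)) p.1 = P.act (ev k f) p.1 + P.act (ev k g) p.1
      rw [ev_add, map_add, LinearMap.add_apply]
    · ext p
      change P.act (ev k (r • f)) p.1 = r • P.act (ev k f) p.1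
      rw [ev_smul, map_smul, LinearMap.smul_apply]

/-- A left contramodule is locally finite if the underlying left module is locally finite. -/
def LeftContramodule.IsLocallyFinite (P : LeftContramodule.{uk, _, w} k (Coalg k E)) : Prop :=
  isLocallyFiniteModule k E (theta P)

variable (k E)

/-- The class of all left modules that are isomorphic to `theta P` for a locally finite left
contramodule `P`. -/
def isThetaOfLocallyFinite : ObjectProperty (LeftMod.{uk, u, v, w} k E) :=
  fun M => ∃ P : LeftContramodule.{uk, _, w} k (Coalg k E),
    P.IsLocallyFinite ∧ Nonempty (theta P ≅ M)

end Contra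

end LinCat

end

/-! A locally finite left module $M$ comes from a contramodule exactly when, for every object $y$,
all morphisms $x\to y$ act by zero on $M$ for almost all $x$ (`HasFiniteSources`,
`isThetaOfLocallyFinite_iff`). This condition is visibly stable under extensions once morphisms can
be factored through a suitable finite set of objects.

Sufficiency: on $\prod_x M(x)$ the infinite sums demanded by a contraaction become finite sums,
which defines `piContramodule`.

Necessity (`exists_finite_act_eq_zero`): in the finite-dimensional space $P^y$ the subspaces
generated by morphisms with source outside a finite set $S$ stabilize as $S$ grows. By left
strictness, the stable subspace at $y$ is generated by morphisms $t\to y$, $t\prec y$, applied to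
the stable subspaces at the objects $t$. A Nakayama argument (`eq_zero_of_section`) shows that such
a family vanishes.

Extensions (`HasFiniteSources.of_exact`): let $S$ be the finite set of sources for $M'$ at $y$. By
`exists_factorsThrough_disjoint`, for almost all $x$ every $f\colon x\to y$ is a sum of composites
$x\to t\to y$ with $t$ in a finite set $T$ disjoint from $S$. For almost all $x$ the map $x\to t$
acts by zero on $M''$, so it sends $M(x)$ into $M'(t)$, which is killed by $t\to y$ because $t\notin
S$. -/

noncomputable section

namespace LinCat

/-! ### Factorization of morphisms through finite sets of objects -/

section Factor

variable (k : Type uk) {E : Type u} [Field k] [Category.{v} E] [Preadditive E] [Linear k E]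

/-- The subspace of all finite sums of morphisms `x ⟶ y` that factor through an object of `T`. -/
def factorsThrough (T : Set E) (x y : E) : Submodule k (x ⟶ y) :=
  Submodule.span k {f | ∃ t ∈ T, ∃ (g : x ⟶ t) (h : t ⟶ y), f = g ≫ h}

variable {k}

lemma comp_mem_factorsThrough {T : Set E} {x t y : E} (ht : t ∈ T) (g : x ⟶ t) (h : t ⟶ y) :
    g ≫ h ∈ factorsThrough k T x y :=
  Submodule.subset_span ⟨t, ht, g, h, rfl⟩

lemma factorsThrough_comp {T T' : Set E} (hT : T ⊆ T') {x y z : E} {f : x ⟶ y}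
    (hf : f ∈ factorsThrough k T x y) (g : y ⟶ z) : f ≫ g ∈ factorsThrough k T' x z := by
  induction hf using Submodule.span_induction with
  | mem f hf =>
    obtain ⟨t, ht, a, b, rfl⟩ := hf
    rw [Category.assoc]
    exact comp_mem_factorsThrough (hT ht) _ _
  | zero => simp
  | add a b _ _ ha hb =>
    rw [Preadditive.add_comp]
    exact add_mem ha hb
  | smul r a _ ha =>
    rw [Linear.smul_comp]
    exact Submodule.smul_mem _ _ ha

lemma Prec.trans {E : Type u} [Category.{v} E] [Preadditive E] {x y z : E} (h : Prec x y) (h' : Prec y z) :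
    Prec x z :=
  Relation.TransGen.trans h h'

lemma Prec.id_left {E : Type u} [Category.{v} E] [Preadditive E] {x y : E} (h : Prec x y) :
    𝟙 x ≠ 0 := by
  intro h0
  obtain ⟨z, ⟨f, hf⟩, -⟩ := Relation.TransGen.head'_iff.1 h
  exact hf (by rw [← Category.id_comp f, h0, Limits.zero_comp])

lemma Prec.refl_left {E : Type u} [Category.{v} E] [Preadditive E] {x y : E} (h : Prec x y) :
    Prec x x :=
  Relation.TransGen.single ⟨_, h.id_left⟩

lemma dual_eq_zero_of_not_prec {x y : E} (h : ¬ Prec x y) (φ : Module.Dual k (x ⟶ y)) : φ = 0 := by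
  ext f
  by_cases hf : f = 0
  · simp [hf]
  · exact absurd (prec_of_ne_zero hf) h

variable (k)

/-- For a finite set `S` of objects of a left strictly locally finite category, almost all
morphisms with a fixed target are finite sums of morphisms that factor through a finite set of
objects outside of `S`. -/
lemma exists_factorsThrough_disjoint [IsLeftStrictlyLocallyFinite k E] {S : Set E}
    (hS : S.Finite) (y : E) : ∃ T R : Set E, T.Finite ∧ R.Finite ∧ Disjoint T S ∧
      ∀ x ∉ R, ∀ f : x ⟶ y, f ∈ factorsThrough k T x y := by
  -- The induction counts the elements of $S$ below $y$. The alternative `s = y` matters because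
  -- $\preceq$ is not reflexive at zero objects. If $y\in S$, passing to a frontier object $t\prec
  -- y$ removes at least $y$ from this set.
  induction hn : {s ∈ S | Prec s y ∨ s = y}.ncard using Nat.strong_induction_on generalizing y with
  | _ n ih =>
    by_cases hy : y ∈ S
    · obtain ⟨X, hX, hXy, hfac⟩ := IsLeftStrictlyLocallyFinite.exists_frontier (k := k) y
      have key : ∀ t ∈ X, ∃ T R : Set E, T.Finite ∧ R.Finite ∧ Disjoint T S ∧
          ∀ x ∉ R, ∀ f : x ⟶ t, f ∈ factorsThrough k T x t := by
        intro t ht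
        refine ih _ ?_ t rfl
        rw [← hn]
        refine Set.ncard_lt_ncard ⟨?_, fun hsub => ?_⟩ (hS.subset (Set.sep_subset _ _))
        · rintro s ⟨hs, h | rfl⟩
          · exact ⟨hs, Or.inl (h.trans (hXy t ht).1)⟩
          · exact ⟨hs, Or.inl (hXy _ ht).1⟩
        · obtain ⟨-, h | h⟩ := hsub ⟨hy, Or.inr rfl⟩
          · exact (hXy t ht).2 h
          · subst h
            exact (hXy _ ht).2 (hXy _ ht).1
      choose! T R hT hR hd hf using key
      -- The finite class of objects equivalent to $y$ is put into $R$, so that a nonzero $f\colon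
      -- x\to y$ with $x\notin R$ has $x\prec y$ and the frontier applies.
      refine ⟨⋃ t ∈ X, T t, (⋃ t ∈ X, R t) ∪ {z | Prec y z ∧ Prec z y}, hX.biUnion hT,
        (hX.biUnion hR).union (IsLocallyFinite.finite_interval (k := k) y y), ?_, ?_⟩
      · simpa only [Set.disjoint_iUnion_left] using hd
      · intro x hx f
        simp only [Set.mem_union, Set.mem_iUnion₂, not_or, exists_prop] at hx
        by_cases hf0 : f = 0
        · rw [hf0]
          exact zero_mem _
        · have hp : Prec x y := Relation.TransGen.single ⟨f, hf0⟩
          obtain ⟨m, z, g, h, hz, rfl⟩ := hfac x f ⟨hp, fun h' => hx.2 ⟨h', hp⟩⟩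
          refine Submodule.sum_mem _ fun i _ => ?_
          have hsub : T (z i) ⊆ ⋃ t ∈ X, T t := fun a ha => Set.mem_biUnion (hz i) ha
          have hg : g i ∈ factorsThrough k (T (z i)) x (z i) :=
            hf (z i) (hz i) x (fun h' => hx.1 ⟨z i, hz i, h'⟩) (g i)
          exact factorsThrough_comp hsub hg (h i)
    · refine ⟨{y}, ∅, Set.finite_singleton y, Set.finite_empty, by simpa, fun x _ f => ?_⟩
      rw [← Category.comp_id f]
      exact comp_mem_factorsThrough (Set.mem_singleton y) f (𝟙 y)

end Factor

/-! ### Exactness in full subcategories -/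

section Exact

open Limits

variable {A B : Type*} [Category A] [Category B] [HasZeroMorphisms B] [Abelian A]

/-- A fully faithful functor to an abelian category whose essential image is closed under
subobjects and quotients preserves exactness. -/
lemma exact_map_of_subobjects_of_quotients (F : B ⥤ A) [F.Full] [F.Faithful]
    [F.PreservesZeroMorphisms]
    (hsub : ∀ (X : B) {Y : A} (i : Y ⟶ F.obj X) [Mono i], F.essImage Y)
    (hquot : ∀ (X : B) {Y : A} (p : F.obj X ⟶ Y) [Epi p], F.essImage Y)
    {S : ShortComplex B} (hS : S.Exact) : (S.map F).Exact := by
  obtain ⟨h, hz⟩ := hS.condition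
  have hz' : IsZero h.left.H := hz
  -- It is not known in advance that `F` preserves the kernel `h.left.K`. The kernel formed in `A`
  -- lies in the essential image, so its inclusion lifts to `B` and factors through `h.left.K`.
  obtain ⟨K, ⟨eK⟩⟩ := hsub S.X₂ (kernel.ι (F.map S.g))
  obtain ⟨ι, hι⟩ := F.map_surjective (eK.hom ≫ kernel.ι (F.map S.g))
  have hιg : ι ≫ S.g = 0 := F.map_injective (by simp [hι])
  let l : K ⟶ h.left.K := h.left.liftK ι hιg
  have hl : l ≫ h.left.i = ι := h.left.liftK_i ι hιg
  -- Likewise the cokernel in `A` of the map to the cycles lifts to a morphism `q` of `B`. It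
  -- factors through the homology, which is zero, so that map is an epimorphism in `A`.
  obtain ⟨Q, ⟨eQ⟩⟩ := hquot h.left.K (cokernel.π (F.map h.left.f'))
  obtain ⟨q, hq⟩ := F.map_surjective (cokernel.π (F.map h.left.f') ≫ eQ.inv)
  have hfq : h.left.f' ≫ q = 0 := F.map_injective (by simp [hq])
  have hq0 : q = 0 := by
    rw [← h.left.π_descH q hfq, hz'.eq_zero_of_src (h.left.descH q hfq), comp_zero]
  have hepi : Epi (F.map h.left.f') := by
    refine Abelian.epi_of_cokernel_π_eq_zero _ ?_
    rw [← cancel_mono eQ.inv, zero_comp, ← hq, hq0, F.map_zero]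
  rw [ShortComplex.exact_iff_exact_up_to_refinements]
  intro Z (z : Z ⟶ F.obj S.X₂) (hz2' : z ≫ F.map S.g = 0)
  let a : Z ⟶ F.obj h.left.K := kernel.lift _ z hz2' ≫ eK.inv ≫ F.map l
  have ha : a ≫ F.map h.left.i = z := by
    simp only [a, Category.assoc]
    rw [← F.map_comp, hl, hι, Iso.inv_hom_id_assoc, kernel.lift_ι]
  obtain ⟨Z', p, hp, b, hb⟩ := surjective_up_to_refinements_of_epi (F.map h.left.f') a
  refine ⟨Z', p, hp, b, ?_⟩
  change p ≫ z = b ≫ F.map S.f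
  rw [← ha, reassoc_of% hb, ← F.map_comp, h.left.f'_i]

end Exact

/-! ### Exact sequences of modules are exact objectwise -/

section ModuleExact

open Limits

variable (k : Type uk) (E : Type u) [Field k] [Category.{v} E] [Preadditive E] [Linear k E]

variable {k E} in
lemma isLeftModule_of_mono {M N : E ⥤ ModuleCat.{w} k} (i : N ⟶ M) [Mono i]
    (hM : isLeftModule k E M) : isLeftModule k E N := by
  obtain ⟨h1, h2⟩ := hM
  refine ⟨⟨fun {x y f g} => ?_⟩, ⟨fun {x y} f r => ?_⟩⟩
  · rw [← cancel_mono (i.app y)]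
    simp [h1.map_add]
  · rw [← cancel_mono (i.app y)]
    simp [h2.map_smul]

variable {k E} in
lemma isLeftModule_of_epi {M N : E ⥤ ModuleCat.{w} k} (p : M ⟶ N) [Epi p]
    (hM : isLeftModule k E M) : isLeftModule k E N := by
  obtain ⟨h1, h2⟩ := hM
  refine ⟨⟨fun {x y f g} => ?_⟩, ⟨fun {x y} f r => ?_⟩⟩
  · rw [← cancel_epi (p.app x), ← p.naturality]
    simp [h1.map_add]
  · rw [← cancel_epi (p.app x), ← p.naturality]
    simp [h2.map_smul]

/-- Linearity passes to subfunctors and quotient functors, so exactness can be tested among all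
functors, where it is objectwise. In the locally finite case below, finite dimension is inherited as
well. -/
lemma leftMod_exact_map {S : ShortComplex (LeftMod.{uk, u, v, w} k E)} (hS : S.Exact) :
    (S.map (isLeftModule.{uk, u, v, w} k E).ι).Exact :=
  exact_map_of_subobjects_of_quotients _
    (fun X _ i _ => ⟨⟨_, isLeftModule_of_mono i X.property⟩, ⟨Iso.refl _⟩⟩)
    (fun X _ p _ => ⟨⟨_, isLeftModule_of_epi p X.property⟩, ⟨Iso.refl _⟩⟩) hS

lemma locFinLeftMod_exact_map {S : ShortComplex (LocFinLeftMod.{uk, u, v, w} k E)}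
    (hS : S.Exact) : (S.map ((isLocallyFiniteModule.{uk, u, v, w} k E).ι ⋙
      (isLeftModule.{uk, u, v, w} k E).ι)).Exact :=
  exact_map_of_subobjects_of_quotients _
    (fun X N i _ => ⟨⟨⟨_, isLeftModule_of_mono i X.obj.property⟩, fun x => by
      have : FiniteDimensional k (X.obj.obj.obj x) := X.property x
      have : Mono (i.app x) := inferInstance
      exact Module.Finite.of_injective (N := X.obj.obj.obj x) (i.app x).hom
        ((ModuleCat.mono_iff_injective _).1 this)⟩,
      ⟨Iso.refl _⟩⟩)
    (fun X N p _ => ⟨⟨⟨_, isLeftModule_of_epi p X.obj.property⟩, fun x => by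
      have : FiniteDimensional k (X.obj.obj.obj x) := X.property x
      have : Epi (p.app x) := inferInstance
      exact Module.Finite.of_surjective (M := X.obj.obj.obj x) (p.app x).hom
        ((ModuleCat.epi_iff_surjective _).1 this)⟩,
      ⟨Iso.refl _⟩⟩) hS

lemma exists_preimage_of_exact {k : Type uk} {E : Type u} [Field k] [Category.{v} E]
    {S : ShortComplex (E ⥤ ModuleCat.{w} k)} (hS : S.Exact) (x : E)
    (m : S.X₂.obj x) (hm : (S.g.app x).hom m = 0) : ∃ m', (S.f.app x).hom m' = m :=
  (ShortComplex.moduleCat_exact_iff _).1 (hS.map ((evaluation E (ModuleCat k)).obj x)) m hm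

end ModuleExact

namespace LeftContramodule

/-! ### The operator that contraassociativity makes invisible to the contraaction -/

section Twist

variable {k : Type uk} {C : Type u} [Field k] [AddCommGroup C] [Module k C] [Coalgebra k C]

/-- The operator `A ↦ (c ↦ ∑ σ (A c₂) c₁)` on the space of linear maps `C ⟶ P`, for a linear map
`σ : P ⟶ Hom(C, P)`. -/
def twist {P : Type w} [AddCommGroup P] [Module k P] (σ : P →ₗ[k] C →ₗ[k] P) :
    (C →ₗ[k] P) →ₗ[k] C →ₗ[k] P where
  toFun A := TensorProduct.lift (σ ∘ₗ A).flip ∘ₗ CoalgebraStruct.comul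
  map_add' A B := by
    rw [← LinearMap.add_comp]
    congr 1
    exact TensorProduct.ext' fun c d => by simp
  map_smul' r A := by
    rw [RingHom.id_apply, ← LinearMap.smul_comp]
    congr 1
    exact TensorProduct.ext' fun c d => by simp

lemma twist_apply {P : Type w} [AddCommGroup P] [Module k P] (σ : P →ₗ[k] C →ₗ[k] P)
    (A : C →ₗ[k] P) (c : C) :
    twist σ A c = TensorProduct.lift (σ ∘ₗ A).flip (CoalgebraStruct.comul c) := rfl

/-- Contraassociativity for $\sigma\circ A$ gives $\pi(\mathrm{twist}_\sigma
A)=\pi(\pi\circ\sigma\circ A)$, and $\sigma$ is a section of $\pi$ on the values of $A$. -/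
lemma contraaction_twist (P : LeftContramodule.{uk, u, w} k C)
    (σ : P.carrier →ₗ[k] C →ₗ[k] P.carrier) (A : C →ₗ[k] P.carrier)
    (h : ∀ c, P.contraaction (σ (A c)) = A c) :
    P.contraaction (twist σ A) = P.contraaction A := by
  refine (P.contraassoc (σ ∘ₗ A)).trans ?_
  congr 1
  ext c
  exact h c

lemma twist_mem {P : Type w} [AddCommGroup P] [Module k P] (σ : P →ₗ[k] C →ₗ[k] P)
    {G : Submodule k P} (hσ : ∀ p c, σ p c ∈ G) (A : C →ₗ[k] P) (c : C) : twist σ A c ∈ G := by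
  rw [twist_apply]
  induction CoalgebraStruct.comul (R := k) c with
  | zero => simp
  | add a b ha hb =>
    rw [map_add]
    exact add_mem ha hb
  | tmul a b => exact hσ _ _

end Twist

/-! ### Local nilpotence and Nakayama's lemma -/

section Tail

variable {k : Type uk} {E : Type u} [Field k] [Category.{v} E] [Preadditive E] [Linear k E]
variable [LinCat.IsLocallyFinite k E]

lemma twist_eq_zero_of_forall {P : Type w} [AddCommGroup P] [Module k P]
    (σ : P →ₗ[k] Coalg k E →ₗ[k] P) (A : Coalg k E →ₗ[k] P) (x y : E)
    (h : ∀ z ∈ interval k E x y, ∀ φ ψ, σ (A (incl k z y ψ)) (incl k x z φ) = 0)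
    (φ : Module.Dual k (x ⟶ y)) : twist σ A (incl k x y φ) = 0 := by
  rw [twist_apply, comul_incl, map_sum]
  refine Finset.sum_eq_zero fun z hz => ?_
  induction comulComponent k x z y φ with
  | zero => simp
  | add a b ha hb => rw [map_add, map_add, ha, hb, add_zero]
  | tmul a b => exact h z hz a b

/-- Each application of the twist splits off a strict step $x\prec z$. The interval from $z$ to $y$
no longer contains $x$, so the interval size bounds the number of nonzero iterates. -/
lemma iterate_twist_eq_zero {P : Type w} [AddCommGroup P] [Module k P]
    (σ : P →ₗ[k] Coalg k E →ₗ[k] P)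
    (hσ : ∀ (p : P) (x y : E), ¬ StrictPrec x y → ∀ φ, σ p (incl k x y φ) = 0)
    (A : Coalg k E →ₗ[k] P) (n : ℕ) (x y : E) (hn : (interval k E x y).card ≤ n)
    (φ : Module.Dual k (x ⟶ y)) : (twist σ ^ n) A (incl k x y φ) = 0 := by
  induction n generalizing x φ with
  | zero =>
    have h : ¬ Prec x y := by
      intro h
      have hx : x ∈ interval k E x y := by
        rw [interval, Set.Finite.mem_toFinset]
        exact ⟨h.refl_left, h⟩
      exact (Finset.card_pos.2 ⟨x, hx⟩).ne' (Nat.le_zero.1 hn)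
    rw [dual_eq_zero_of_not_prec h φ, map_zero, map_zero]
  | succ n ih =>
    rw [pow_succ', Module.End.mul_apply]
    refine twist_eq_zero_of_forall σ _ x y (fun z hz φ ψ => ?_) φ
    by_cases hxz : StrictPrec x z
    · rw [ih z ?_ ψ, map_zero, LinearMap.zero_apply]
      refine Nat.le_of_lt_succ (lt_of_lt_of_le (Finset.card_lt_card ?_) hn)
      simp only [interval, Set.Finite.mem_toFinset] at hz ⊢
      refine Finset.ssubset_iff_of_subset (fun t ht => ?_) |>.2 ⟨x, ?_, fun hx => ?_⟩
      · simp only [Set.Finite.mem_toFinset, Set.mem_ofPred_eq] at ht ⊢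
        exact ⟨hxz.1.trans ht.1, ht.2⟩
      · simp only [Set.Finite.mem_toFinset, Set.mem_ofPred_eq]
        exact ⟨hz.1.refl_left, hxz.1.trans hz.2⟩
      · simp only [Set.Finite.mem_toFinset, Set.mem_ofPred_eq] at hx
        exact hxz.2 hx.1
    · exact hσ _ x z hxz φ

/-- If `twist σ` is locally nilpotent, then `1 - twist σ` is surjective. -/
lemma exists_sub_twist_eq {P : Type w} [AddCommGroup P] [Module k P]
    (σ : P →ₗ[k] Coalg k E →ₗ[k] P)
    (hσ : ∀ (p : P) (x y : E), ¬ StrictPrec x y → ∀ φ, σ p (incl k x y φ) = 0)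
    (A₀ : Coalg k E →ₗ[k] P) : ∃ A : Coalg k E →ₗ[k] P, A = A₀ + twist σ A := by
  let N : E → E → ℕ := fun x y => (interval k E x y).card
  -- The Neumann series $\sum_n \mathrm{twist}_\sigma^n A_0$, cut off on each summand where its
  -- terms begin to vanish.
  let A : Coalg k E →ₗ[k] P :=
    desc fun x y => (∑ n ∈ Finset.range (N x y), (twist σ ^ n) A₀) ∘ₗ incl k x y
  have hA : ∀ x y m, N x y ≤ m → ∀ φ, A (incl k x y φ) =
      (∑ n ∈ Finset.range m, (twist σ ^ n) A₀) (incl k x y φ) := by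
    intro x y m hm φ
    simp only [A, desc_incl, LinearMap.comp_apply, LinearMap.sum_apply]
    refine Finset.sum_subset (Finset.range_mono hm) fun n _ hn => ?_
    exact iterate_twist_eq_zero σ hσ A₀ n x y (by simpa using hn) φ
  refine ⟨A, Coalg.hom_ext fun x y φ => ?_⟩
  -- One bound valid for all the summands $\operatorname{Hom}(z,y)^*$ entering the twist at $(x,y)$,
  -- so that there `A` may be replaced by a single partial sum.
  let m := N x y + ∑ z ∈ interval k E x y, N z y
  let B : Coalg k E →ₗ[k] P := ∑ n ∈ Finset.range m, (twist σ ^ n) A₀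
  have hB : twist σ A (incl k x y φ) = twist σ B (incl k x y φ) := by
    rw [← sub_eq_zero, ← LinearMap.sub_apply, ← map_sub]
    refine twist_eq_zero_of_forall σ _ x y (fun z hz φ ψ => ?_) φ
    have hz' : N z y ≤ m := (Finset.single_le_sum (f := fun z => N z y)
      (fun _ _ => Nat.zero_le _) hz).trans (Nat.le_add_left _ _)
    rw [LinearMap.sub_apply, hA z y m hz', sub_self, map_zero, LinearMap.zero_apply]
  have hB' : A₀ + twist σ B = ∑ n ∈ Finset.range (m + 1), (twist σ ^ n) A₀ := by
    rw [Finset.sum_range_succ', map_sum, pow_zero, Module.End.one_apply, add_comm]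
    congr 1
    exact Finset.sum_congr rfl fun n _ => by rw [pow_succ', Module.End.mul_apply]
  rw [LinearMap.add_apply, hB, ← LinearMap.add_apply, hB']
  exact hA x y (m + 1) (Nat.le_succ_of_le (Nat.le_add_right _ _)) φ

/-- Nakayama's lemma: a subspace whose elements are contraactions of maps with values in this
subspace that are supported on strictly decreasing pairs of objects vanishes. -/
lemma eq_zero_of_section (P : LeftContramodule.{uk, _, w} k (Coalg k E))
    (G : Submodule k P.carrier) (σ : P.carrier →ₗ[k] Coalg k E →ₗ[k] P.carrier)
    (hσ : ∀ (p : P.carrier) (x y : E), ¬ StrictPrec x y → ∀ φ, σ p (incl k x y φ) = 0)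
    (hG : ∀ p c, σ p c ∈ G) (hπ : ∀ p ∈ G, P.contraaction (σ p) = p) {p : P.carrier}
    (hp : p ∈ G) : p = 0 := by
  -- Applying $\pi$ to this equation for $A$ yields $\pi(A)=p+\pi(A)$, by contraunitality and
  -- `contraaction_twist`.
  obtain ⟨A, hA⟩ := exists_sub_twist_eq σ hσ (CoalgebraStruct.counit.smulRight p)
  have hAG : ∀ c, A c ∈ G := fun c => by
    rw [hA]
    exact add_mem (G.smul_mem _ hp) (twist_mem σ hG A c)
  have h1 := P.contraaction_twist σ A fun c => hπ _ (hAG c)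
  have h2 := congrArg P.contraaction hA
  rw [map_add, P.contraunit, h1] at h2
  simpa using h2

/-! ### Tails and their stable intersections -/

section Residue

variable (P : LeftContramodule.{uk, _, w} k (Coalg k E))

/-- The subspace of `P^y` spanned by the images of the action maps of all morphisms `x ⟶ y`
with `x` outside of `S`. -/
def tail (S : Set E) (y : E) : Submodule k P.carrier :=
  Submodule.span k {p | ∃ x ∉ S, ∃ (f : x ⟶ y) (q : P.carrier), p = P.act (ev k f) q}

lemma act_mem_tail {S : Set E} {x y : E} (hx : x ∉ S) (f : x ⟶ y) (q : P.carrier) :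
    P.act (ev k f) q ∈ P.tail S y :=
  Submodule.subset_span ⟨x, hx, f, q, rfl⟩

lemma tail_anti {S S' : Set E} (h : S ⊆ S') (y : E) : P.tail S' y ≤ P.tail S y := by
  refine Submodule.span_mono ?_
  rintro _ ⟨x, hx, f, q, rfl⟩
  exact ⟨x, fun h' => hx (h h'), f, q, rfl⟩

lemma tail_le_component (S : Set E) (y : E) : P.tail S y ≤ P.component y := by
  refine Submodule.span_le.2 ?_
  rintro _ ⟨x, hx, f, q, rfl⟩
  exact ⟨P.act (ev k f) q, by rw [act_ev_act_ev, Category.comp_id]⟩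

lemma act_id_of_mem_component {y : E} {p : P.carrier} (hp : p ∈ P.component y) :
    P.act (ev k (𝟙 y)) p = p := by
  obtain ⟨q, rfl⟩ := hp
  rw [act_ev_act_ev, Category.comp_id]

lemma act_id_of_mem_component_of_ne {y z : E} (h : y ≠ z) {p : P.carrier}
    (hp : p ∈ P.component y) : P.act (ev k (𝟙 z)) p = 0 := by
  obtain ⟨q, rfl⟩ := hp
  rw [act_act, ev_tmul_ev_comp_comul_of_ne k _ _ h, map_zero, LinearMap.zero_apply]

/-- The intersection of the subspaces `tail S y` over all finite sets `S`. -/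
def residue (y : E) : Submodule k P.carrier := ⨅ S : {S : Set E // S.Finite}, P.tail S y

lemma residue_le_tail {S : Set E} (hS : S.Finite) (y : E) : P.residue y ≤ P.tail S y :=
  iInf_le (fun S : {S : Set E // S.Finite} => P.tail S y) ⟨S, hS⟩

lemma residue_le_component (y : E) : P.residue y ≤ P.component y :=
  (P.residue_le_tail Set.finite_empty y).trans (P.tail_le_component _ y)

/-- Choose $S$ with the tail of least dimension. Enlarging $S$ by any finite $S'$ leaves this tail
unchanged, so it lies in the tail of $S'$. -/
lemma exists_tail_le_residue (hP : P.IsLocallyFinite) (y : E) :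
    ∃ S : Set E, S.Finite ∧ P.tail S y ≤ P.residue y := by
  have : FiniteDimensional k (P.component y) := hP y
  have hfin : ∀ S : Set E, FiniteDimensional k (P.tail S y) := fun S =>
    Submodule.finiteDimensional_of_le (P.tail_le_component S y)
  obtain ⟨⟨S, hS⟩, hmin⟩ := exists_minimalFor_of_wellFoundedLT
    (fun _ : {S : Set E // S.Finite} => True) (fun S => Module.finrank k (P.tail S.1 y))
    ⟨⟨∅, Set.finite_empty⟩, trivial⟩
  refine ⟨S, hS, le_iInf fun S' => ?_⟩
  have hle := P.tail_anti (Set.subset_union_left (s := S) (t := S')) y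
  have := hfin S
  have h := Submodule.eq_of_le_of_finrank_le hle
    (hmin.2 (j := ⟨S ∪ S', hS.union S'.2⟩) trivial (Submodule.finrank_mono hle))
  rw [← h]
  exact P.tail_anti Set.subset_union_right y

/-- The linear maps `Coalg k E ⟶ P` that are supported on pairs `t ≺ y` for the fixed object `y`
and take values in the subspaces `residue t`. -/
def residueHom (y : E) : Submodule k (Coalg k E →ₗ[k] P.carrier) where
  carrier := {A | ∀ (t z : E) (φ : Module.Dual k (t ⟶ z)), A (incl k t z φ) ∈ P.residue t ∧
    (¬ (StrictPrec t z ∧ z = y) → A (incl k t z φ) = 0)}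
  add_mem' {A B} hA hB t z φ := ⟨add_mem (hA t z φ).1 (hB t z φ).1, fun h => by
    rw [LinearMap.add_apply, (hA t z φ).2 h, (hB t z φ).2 h, add_zero]⟩
  zero_mem' t z φ := ⟨zero_mem _, fun _ => rfl⟩
  smul_mem' r A hA t z φ := ⟨Submodule.smul_mem _ r (hA t z φ).1, fun h => by
    rw [LinearMap.smul_apply, (hA t z φ).2 h, smul_zero]⟩

lemma smulRight_ev_mem_residueHom {t y : E} (h : StrictPrec t y) (f : t ⟶ y) {u : P.carrier}
    (hu : u ∈ P.residue t) : (ev k f).smulRight u ∈ P.residueHom y := by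
  intro t' z φ
  rw [LinearMap.smulRight_apply]
  by_cases hne : t' = t ∧ z = y
  · obtain ⟨rfl, rfl⟩ := hne
    exact ⟨Submodule.smul_mem _ _ hu, fun h' => absurd ⟨h, rfl⟩ h'⟩
  · rw [ev_incl_of_ne f φ hne, zero_smul]
    exact ⟨zero_mem _, fun _ => rfl⟩

end Residue

end Tail

/-! ### Vanishing of the residues in a locally finite contramodule -/

section Vanish

variable {k : Type uk} {E : Type u} [Field k] [Category.{v} E] [Preadditive E] [Linear k E]
variable [IsLeftStrictlyLocallyFinite k E] (P : LeftContramodule.{uk, _, w} k (Coalg k E))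

/-- The frontier of $y$ is finite, so one finite set $S'$ contains sets at which the tails of all
frontier objects are already stable. A morphism $x\to y$ with $x\notin S'$ is a sum of composites
$x\to z_i\to y$, whose first factors land in the residues at the $z_i$. -/
lemma residue_le_map_residueHom (hP : P.IsLocallyFinite)
    (y : E) : P.residue y ≤ (P.residueHom y).map P.contraaction := by
  obtain ⟨X, hX, hXy, hfac⟩ := IsLeftStrictlyLocallyFinite.exists_frontier (k := k) y
  choose S hS hSle using P.exists_tail_le_residue hP
  let S' : Set E := (⋃ t ∈ X, S t) ∪ {z | Prec y z ∧ Prec z y}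
  have hS' : S'.Finite := (hX.biUnion fun t _ => hS t).union
    (LinCat.IsLocallyFinite.finite_interval (k := k) y y)
  refine (P.residue_le_tail hS' y).trans (Submodule.span_le.2 ?_)
  rintro _ ⟨x, hx, f, q, rfl⟩
  by_cases hf0 : f = 0
  · have : ev k f = 0 := by simp [hf0, ev]
    rw [this, map_zero]
    exact zero_mem _
  · have hp : Prec x y := prec_of_ne_zero hf0
    obtain ⟨n, z, g, h, hz, rfl⟩ := hfac x f ⟨hp, fun h' => hx (Or.inr ⟨h', hp⟩)⟩
    have hsum : P.act (ev k (∑ i, g i ≫ h i)) q =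
        ∑ i, P.act (ev k (h i)) (P.act (ev k (g i)) q) := by
      simp only [act_ev_act_ev]
      have : ev k (∑ i, g i ≫ h i) = ∑ i, ev k (g i ≫ h i) := by
        simp only [ev, map_sum]
        exact LinearMap.ext fun c => by simp
      rw [this, map_sum, LinearMap.sum_apply]
    rw [hsum]
    refine Submodule.sum_mem _ fun i _ => ?_
    have hu : P.act (ev k (g i)) q ∈ P.residue (z i) := by
      refine hSle (z i) (P.act_mem_tail (fun h' => hx (Or.inl ?_)) (g i) q)
      exact Set.mem_biUnion (hz i) h'
    exact ⟨_, P.smulRight_ev_mem_residueHom (hXy _ (hz i)) (h i) hu, rfl⟩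

lemma exists_section_residue (hP : P.IsLocallyFinite)
    (y : E) : ∃ s : P.carrier →ₗ[k] Coalg k E →ₗ[k] P.carrier, (∀ p, s p ∈ P.residueHom y) ∧
      ∀ p ∈ P.residue y, P.contraaction (s p) = p := by
  let f : P.residueHom y →ₗ[k] (P.residueHom y).map P.contraaction :=
    P.contraaction.submoduleMap (P.residueHom y)
  obtain ⟨g, hg⟩ := f.exists_rightInverse_of_surjective
    (LinearMap.range_eq_top.2 (P.contraaction.submoduleMap_surjective _))
  obtain ⟨e, he⟩ := LinearMap.exists_extend g
  refine ⟨(P.residueHom y).subtype ∘ₗ e, fun p => (e p).2, fun p hp => ?_⟩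
  have hp' := P.residue_le_map_residueHom hP y hp
  have h1 : e p = g ⟨p, hp'⟩ := LinearMap.congr_fun he ⟨p, hp'⟩
  have h2 := congrArg Subtype.val (LinearMap.congr_fun hg ⟨p, hp'⟩)
  rw [LinearMap.comp_apply, Submodule.subtype_apply, h1]
  exact h2

/-- Nakayama's lemma is applied to the sum of all the residues at once, which requires gluing the
sections chosen at the individual objects into one linear map. -/
lemma residue_eq_bot (hP : P.IsLocallyFinite) (y : E) :
    P.residue y = ⊥ := by
  choose s hs hπ using P.exists_section_residue hP
  -- On $\operatorname{Hom}(t,z)^*$ the element is first projected to $P^z$ by the idempotent of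
  -- $z$. Hence on the residue at $z$ only the section `s z` survives.
  let σ : P.carrier →ₗ[k] Coalg k E →ₗ[k] P.carrier :=
    { toFun := fun p => desc fun t z => s z (P.act (ev k (𝟙 z)) p) ∘ₗ incl k t z
      map_add' := fun p q => Coalg.hom_ext fun t z φ => by simp
      map_smul' := fun r p => Coalg.hom_ext fun t z φ => by simp }
  have hσ : ∀ p t z φ, σ p (incl k t z φ) = s z (P.act (ev k (𝟙 z)) p) (incl k t z φ) :=
    fun p t z φ => by simp [σ]
  have hσy : ∀ z, ∀ p ∈ P.residue z, σ p = s z p := by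
    intro z p hp
    have hp' := P.residue_le_component z hp
    refine Coalg.hom_ext fun t z' φ => ?_
    rw [hσ]
    by_cases hz : z = z'
    · subst hz
      rw [P.act_id_of_mem_component hp']
    · rw [P.act_id_of_mem_component_of_ne hz hp', map_zero, LinearMap.zero_apply,
        (hs z p t z' φ).2 (by tauto)]
  refine (Submodule.eq_bot_iff _).2 fun p hp => ?_
  refine P.eq_zero_of_section (⨆ t, P.residue t) σ ?_ ?_ ?_ (Submodule.mem_iSup_of_mem y hp)
  · intro p t z h φ
    rw [hσ]
    exact (hs z _ t z φ).2 (by tauto)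
  · intro p
    -- Passing to the quotient turns membership of all values into an equality of linear maps, which
    -- can be checked on the summands.
    suffices h : (⨆ t, P.residue t).mkQ ∘ₗ σ p = 0 from fun c =>
      (Submodule.Quotient.mk_eq_zero _).1 (LinearMap.congr_fun h c)
    refine Coalg.hom_ext fun t z φ => (Submodule.Quotient.mk_eq_zero _).2 ?_
    rw [hσ]
    exact Submodule.mem_iSup_of_mem t (hs z _ t z φ).1
  · intro p hp
    induction hp using Submodule.iSup_induction' with
    | mem z p hp => rw [hσy z p hp, hπ z p hp]
    | zero => simp
    | add a b _ _ ha hb => rw [map_add, map_add, ha, hb]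

/-- In a locally finite left contramodule, almost all morphisms with a fixed target act by zero. -/
lemma exists_finite_act_eq_zero (hP : P.IsLocallyFinite)
    (y : E) : ∃ S : Set E, S.Finite ∧ ∀ x ∉ S, ∀ (f : x ⟶ y) p, P.act (ev k f) p = 0 := by
  obtain ⟨S, hS, hle⟩ := P.exists_tail_le_residue hP y
  rw [P.residue_eq_bot hP y] at hle
  exact ⟨S, hS, fun x hx f p => (Submodule.mem_bot k).1 (hle (P.act_mem_tail hx f p))⟩

end Vanish

end LeftContramodule

/-! ### Contraction of linear maps along morphisms -/

section Contraction

/-- By finite dimension, expansion in bases writes every bilinear map on the duals as a finite sum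
of maps $(\varphi,\psi)\mapsto\varphi(a)\psi(b)n$. -/
lemma bilinear_dual_induction {k V W N : Type*} [Field k] [AddCommGroup V] [Module k V]
    [FiniteDimensional k V] [AddCommGroup W] [Module k W] [FiniteDimensional k W]
    [AddCommGroup N] [Module k N] {Q : (Module.Dual k V →ₗ[k] Module.Dual k W →ₗ[k] N) → Prop}
    (zero : Q 0) (add : ∀ A B, Q A → Q B → Q (A + B))
    (smulRight : ∀ (a : V) (b : W) (n : N),
      Q ((Module.Dual.eval k V a).smulRight ((Module.Dual.eval k W b).smulRight n)))
    (B : Module.Dual k V →ₗ[k] Module.Dual k W →ₗ[k] N) : Q B := by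
  let b := Module.finBasis k V
  let c := Module.finBasis k W
  have h : B = ∑ i, ∑ j, (Module.Dual.eval k V (b i)).smulRight
      ((Module.Dual.eval k W (c j)).smulRight (B (b.coord i) (c.coord j))) := by
    refine LinearMap.ext fun φ => LinearMap.ext fun ψ => ?_
    simp only [LinearMap.sum_apply, LinearMap.smulRight_apply, LinearMap.smul_apply,
      Module.Dual.eval_apply]
    conv_lhs => rw [← b.sum_dual_apply_smul_coord φ, ← c.sum_dual_apply_smul_coord ψ]
    simp only [map_sum, LinearMap.sum_apply, map_smul, LinearMap.smul_apply]
    rw [Finset.sum_comm]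
    refine Finset.sum_congr rfl fun j _ => ?_
    rw [Finset.smul_sum]
    exact Finset.sum_congr rfl fun i _ => smul_comm _ _ _
  rw [h]
  exact Finset.sum_induction _ Q add zero fun i _ => Finset.sum_induction _ Q add zero
    fun j _ => smulRight _ _ _

variable {k : Type uk} {E : Type u} [Field k] [Category.{v} E] [Preadditive E] [Linear k E]
variable [IsLocallyFinite k E]

/-- The linear map `Hom(Hom(x, y)^*, M(x)) ⟶ M(y)` induced by the action of the morphisms `x ⟶ y`
in a left module `M`. -/
def contraction (M : LeftMod.{uk, u, v, w} k E) (x y : E) :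
    (Module.Dual k (x ⟶ y) →ₗ[k] M.obj.obj x) →ₗ[k] M.obj.obj y :=
  ∑ i, (M.obj.map (Module.finBasis k (x ⟶ y) i)).hom ∘ₗ
    LinearMap.applyₗ ((Module.finBasis k (x ⟶ y)).coord i)

variable (M : LeftMod.{uk, u, v, w} k E)

lemma contraction_apply (x y : E) (α : Module.Dual k (x ⟶ y) →ₗ[k] M.obj.obj x) :
    contraction M x y α = ∑ i, (M.obj.map (Module.finBasis k (x ⟶ y) i)).hom
      (α ((Module.finBasis k (x ⟶ y)).coord i)) := by
  simp [contraction, LinearMap.sum_apply]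

/-- The action of morphisms in a left module as a linear map. -/
def actionₗ (x y : E) : (x ⟶ y) →ₗ[k] M.obj.obj x →ₗ[k] M.obj.obj y where
  toFun f := (M.obj.map f).hom
  map_add' f g := by
    have := M.property.1
    rw [M.obj.map_add, ModuleCat.hom_add]
  map_smul' r f := by
    have := M.property.1
    have := M.property.2
    rw [M.obj.map_smul, ModuleCat.hom_smul, RingHom.id_apply]

/-- This formula frees `contraction` from the chosen basis. It follows by expanding $f$ in that
basis, since the action is linear in $f$. -/
lemma contraction_smulRight {x y : E} (f : x ⟶ y) (m : M.obj.obj x) :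
    contraction M x y ((Module.Dual.eval k (x ⟶ y) f).smulRight m) = (M.obj.map f).hom m := by
  have h : ∀ g : x ⟶ y, (M.obj.map g).hom m = (actionₗ M x y).flip m g := fun _ => rfl
  rw [contraction_apply, h f]
  conv_rhs => rw [← (Module.finBasis k (x ⟶ y)).sum_repr f, map_sum]
  refine Finset.sum_congr rfl fun i _ => ?_
  rw [LinearMap.smulRight_apply, map_smul, map_smul, h]
  rfl

lemma contraction_of_not_prec {x y : E} (h : ¬ Prec x y)
    (α : Module.Dual k (x ⟶ y) →ₗ[k] M.obj.obj x) : contraction M x y α = 0 := by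
  have : α = 0 := LinearMap.ext fun φ => by rw [dual_eq_zero_of_not_prec h φ, map_zero, map_zero]
  rw [this, map_zero]

lemma contraction_of_map_eq_zero {x y : E} (h : ∀ f : x ⟶ y, M.obj.map f = 0)
    (α : Module.Dual k (x ⟶ y) →ₗ[k] M.obj.obj x) : contraction M x y α = 0 := by
  rw [contraction_apply]
  exact Finset.sum_eq_zero fun i _ => by simp [h]

/-- This is the local form of contraassociativity. On a rank-one `B` given by $g$, $h$ and $m$ it
says $M(g≫h)m=M(h)M(g)m$. -/
lemma contraction_comulComponent (x z y : E)
    (B : Module.Dual k (x ⟶ z) →ₗ[k] Module.Dual k (z ⟶ y) →ₗ[k] M.obj.obj x) :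
    contraction M x y (TensorProduct.lift B ∘ₗ comulComponent k x z y) =
      contraction M z y (contraction M x z ∘ₗ B.flip) := by
  induction B using bilinear_dual_induction with
  | zero =>
    have h1 : TensorProduct.lift (0 : Module.Dual k (x ⟶ z) →ₗ[k] Module.Dual k (z ⟶ y) →ₗ[k]
        M.obj.obj x) = 0 := TensorProduct.ext' fun _ _ => by simp
    have h2 : (0 : Module.Dual k (x ⟶ z) →ₗ[k] Module.Dual k (z ⟶ y) →ₗ[k]
        M.obj.obj x).flip = 0 := rfl
    rw [h1, h2, LinearMap.zero_comp, LinearMap.comp_zero, map_zero, map_zero]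
  | add A B hA hB =>
    have h1 : TensorProduct.lift (A + B) = TensorProduct.lift A + TensorProduct.lift B :=
      TensorProduct.ext' fun _ _ => by simp
    have h2 : (A + B).flip = A.flip + B.flip := rfl
    rw [h1, h2, LinearMap.add_comp, LinearMap.comp_add, map_add, map_add, hA, hB]
  | smulRight g h m =>
    have h1 : TensorProduct.lift ((Module.Dual.eval k (x ⟶ z) g).smulRight
        ((Module.Dual.eval k (z ⟶ y) h).smulRight m)) ∘ₗ comulComponent k x z y =
        (Module.Dual.eval k (x ⟶ y) (g ≫ h)).smulRight m := by
      refine LinearMap.ext fun φ => ?_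
      rw [LinearMap.smulRight_apply, Module.Dual.eval_apply,
        ← dualDistrib_comulComponent k x z y φ g h,
        LinearMap.comp_apply]
      induction comulComponent k x z y φ with
      | zero => simp
      | add a b ha hb => simp only [map_add, ha, hb, LinearMap.add_apply, add_smul]
      | tmul a b => simp [smul_smul]
    have h2 : contraction M x z ∘ₗ ((Module.Dual.eval k (x ⟶ z) g).smulRight
        ((Module.Dual.eval k (z ⟶ y) h).smulRight m)).flip =
        (Module.Dual.eval k (z ⟶ y) h).smulRight ((M.obj.map g).hom m) := by
      refine LinearMap.ext fun φ => ?_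
      rw [LinearMap.smulRight_apply, ← contraction_smulRight, ← map_smul, LinearMap.comp_apply]
      congr 1
      refine LinearMap.ext fun ψ => ?_
      exact smul_comm (ψ g) (φ h) m
    rw [h1, h2, contraction_smulRight, contraction_smulRight, M.obj.map_comp]
    rfl

end Contraction

/-! ### The contramodule on the product of the values of a module -/

section Construct

variable {k : Type uk} {E : Type u} [Field k] [Category.{v} E] [Preadditive E] [Linear k E]
variable (M : LeftMod.{uk, u, v, max u w} k E)

/-- The part of a linear map from the coalgebra to `∏ M(x)` that is contracted into `M(y)`. -/
def piComponent (x y : E) : (Coalg k E →ₗ[k] ∀ x, M.obj.obj x) →ₗ[k]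
    Module.Dual k (x ⟶ y) →ₗ[k] M.obj.obj x where
  toFun A := LinearMap.proj x ∘ₗ A ∘ₗ incl k x y
  map_add' _ _ := rfl
  map_smul' _ _ := rfl

lemma piComponent_apply (x y : E) (A : Coalg k E →ₗ[k] ∀ x, M.obj.obj x)
    (φ : Module.Dual k (x ⟶ y)) : piComponent M x y A φ = A (incl k x y φ) x := rfl

variable [IsLocallyFinite k E]

/-- The contraaction in `∏ M(x)` given by summation over finite sets of sources of morphisms. -/
def piContraaction (S : E → Finset E) :
    (Coalg k E →ₗ[k] ∀ x, M.obj.obj x) →ₗ[k] ∀ x, M.obj.obj x :=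
  LinearMap.pi fun y => ∑ x ∈ S y, contraction M x y ∘ₗ piComponent M x y

lemma piContraaction_apply (S : E → Finset E) (A : Coalg k E →ₗ[k] ∀ x, M.obj.obj x) (y : E) :
    piContraaction M S A y = ∑ x ∈ S y, contraction M x y (piComponent M x y A) := by
  simp [piContraaction, LinearMap.sum_apply]

variable {M} {S : E → Finset E} (hS : ∀ y, ∀ x ∉ S y, ∀ f : x ⟶ y, M.obj.map f = 0)

include hS in
lemma piContraaction_ev {x y : E} (f : x ⟶ y) (p : ∀ x, M.obj.obj x) :
    piContraaction M S ((ev k f).smulRight p) y = (M.obj.map f).hom (p x) := by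
  rw [piContraaction_apply, Finset.sum_eq_single x]
  · rw [← contraction_smulRight]
    congr 1
    refine LinearMap.ext fun φ => ?_
    simp [piComponent_apply]
  · intro z _ hz
    convert map_zero (contraction M z y)
    refine LinearMap.ext fun φ => ?_
    rw [piComponent_apply, LinearMap.smulRight_apply, ev_incl_of_ne f φ (by tauto), zero_smul]
    rfl
  · exact fun hx => contraction_of_map_eq_zero M (hS y x hx) _

lemma piContraaction_ev_of_ne {x y z : E} (f : x ⟶ y) (h : y ≠ z) (p : ∀ x, M.obj.obj x) :
    piContraaction M S ((ev k f).smulRight p) z = 0 := by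
  rw [piContraaction_apply]
  refine Finset.sum_eq_zero fun t _ => ?_
  convert map_zero (contraction M t z)
  refine LinearMap.ext fun φ => ?_
  rw [piComponent_apply, LinearMap.smulRight_apply, ev_incl_of_ne f φ (by tauto), zero_smul]
  rfl

-- In the component at $y$ only the summands $\operatorname{Hom}(x,y)^*$ enter, and on these the
-- counit agrees with evaluation at $\mathrm{id}_y$.
include hS in
lemma piContraaction_counit (p : ∀ x, M.obj.obj x) :
    piContraaction M S (CoalgebraStruct.counit.smulRight p) = p := by
  funext y
  refine Eq.trans ?_ ((piContraaction_ev hS (𝟙 y) p).trans (by simp))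
  rw [piContraaction_apply, piContraaction_apply]
  refine Finset.sum_congr rfl fun x _ => congrArg _ (LinearMap.ext fun φ => ?_)
  rw [piComponent_apply, piComponent_apply, LinearMap.smulRight_apply, LinearMap.smulRight_apply,
    counit_incl_eq_ev_left]

-- With $t(z,x)$ the contraction along $z\to x\to y$, the left side sums over $z\in S_y$ and $x$ in
-- the interval from $z$ to $y$, the right side over $x\in S_y$ and $z\in S_x$. Since $t$ vanishes
-- outside each of these ranges and also unless both $z,x\in S_y$, both sums equal the one over
-- $S_y\times S_y$.
include hS in
lemma piContraaction_assoc (F : Coalg k E →ₗ[k] Coalg k E →ₗ[k] ∀ x, M.obj.obj x) :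
    piContraaction M S (TensorProduct.lift F.flip ∘ₗ CoalgebraStruct.comul) =
      piContraaction M S (piContraaction M S ∘ₗ F) := by
  classical
  funext y
  let B : ∀ z x, Module.Dual k (z ⟶ x) →ₗ[k] Module.Dual k (x ⟶ y) →ₗ[k] M.obj.obj z :=
    fun z x => LinearMap.mk₂ k (fun ψ φ => F (incl k x y φ) (incl k z x ψ) z)
      (fun _ _ _ => by simp) (fun _ _ _ => by simp) (fun _ _ _ => by simp) (fun _ _ _ => by simp)
  let t : E → E → M.obj.obj y := fun z x =>
    contraction M z y (TensorProduct.lift (B z x) ∘ₗ comulComponent k z x y)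
  have ht : ∀ z x, t z x = contraction M x y (contraction M z x ∘ₗ (B z x).flip) :=
    fun z x => contraction_comulComponent M z x y _
  have h1 : ∀ z x, z ∉ S y → t z x = 0 := fun z x h => contraction_of_map_eq_zero M (hS y z h) _
  have h2 : ∀ z x, x ∉ S y → t z x = 0 := fun z x h => by
    rw [ht]
    exact contraction_of_map_eq_zero M (hS y x h) _
  have h3 : ∀ z x, z ∉ S x → t z x = 0 := fun z x h => by
    rw [ht]
    convert map_zero (contraction M x y)
    exact LinearMap.ext fun φ => contraction_of_map_eq_zero M (hS x z h) _
  have h4 : ∀ z x, x ∉ interval k E z y → t z x = 0 := fun z x h => by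
    rw [ht]
    by_cases hzx : Prec z x
    · refine contraction_of_not_prec M (fun hxy => h ?_) _
      rw [interval, Set.Finite.mem_toFinset]
      exact ⟨hzx, hxy⟩
    · convert map_zero (contraction M x y)
      exact LinearMap.ext fun φ => contraction_of_not_prec M hzx _
  have hl : piContraaction M S (TensorProduct.lift F.flip ∘ₗ CoalgebraStruct.comul) y =
      ∑ z ∈ S y, ∑ x ∈ S y, t z x := by
    rw [piContraaction_apply]
    refine Finset.sum_congr rfl fun z _ => ?_
    have h : piComponent M z y (TensorProduct.lift F.flip ∘ₗ CoalgebraStruct.comul) =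
        ∑ x ∈ interval k E z y, TensorProduct.lift (B z x) ∘ₗ comulComponent k z x y := by
      refine LinearMap.ext fun φ => ?_
      rw [piComponent_apply, LinearMap.comp_apply, comul_incl, map_sum, Finset.sum_apply,
        LinearMap.sum_apply]
      refine Finset.sum_congr rfl fun x _ => ?_
      rw [LinearMap.comp_apply]
      induction comulComponent k z x y φ with
      | zero => simp
      | add a b ha hb => rw [map_add, map_add, map_add, Pi.add_apply, ha, hb]
      | tmul a b => simp [B]
    rw [h, map_sum]
    change ∑ x ∈ interval k E z y, t z x = _
    rw [Finset.sum_subset (Finset.subset_union_left (s₂ := S y)) fun x _ hx => h4 z x hx]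
    exact (Finset.sum_subset Finset.subset_union_right fun x _ hx => h2 z x hx).symm
  have hr : piContraaction M S (piContraaction M S ∘ₗ F) y = ∑ x ∈ S y, ∑ z ∈ S y, t z x := by
    rw [piContraaction_apply]
    refine Finset.sum_congr rfl fun x _ => ?_
    have h : piComponent M x y (piContraaction M S ∘ₗ F) =
        ∑ z ∈ S x, contraction M z x ∘ₗ (B z x).flip := by
      refine LinearMap.ext fun φ => ?_
      rw [piComponent_apply, LinearMap.comp_apply, piContraaction_apply, LinearMap.sum_apply]
      exact Finset.sum_congr rfl fun z _ => rfl
    rw [h, map_sum]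
    simp only [← ht]
    rw [Finset.sum_subset (Finset.subset_union_left (s₂ := S y)) fun z _ hz => h3 z x hz]
    exact (Finset.sum_subset Finset.subset_union_right fun z _ hz => h1 z x hz).symm
  rw [hl, hr, Finset.sum_comm]

/-- The left contramodule structure on the product of the values of a left module in which almost
all morphisms with a fixed target act by zero. -/
def piContramodule (hS : ∀ y, ∀ x ∉ S y, ∀ f : x ⟶ y, M.obj.map f = 0) :
    LeftContramodule.{uk, _, max u w} k (Coalg k E) where
  carrier := ∀ x, M.obj.obj x
  contraaction := piContraaction M S
  contraassoc := piContraaction_assoc hS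
  contraunit := piContraaction_counit hS

lemma piContramodule_act {x y : E} (f : x ⟶ y) (p : (piContramodule hS).carrier) :
    ((piContramodule hS).act (ev k f) p : ∀ x, M.obj.obj x) y = (M.obj.map f).hom (p x) :=
  piContraaction_ev hS f p

lemma piContramodule_act_of_ne {x y z : E} (f : x ⟶ y) (h : y ≠ z)
    (p : (piContramodule hS).carrier) :
    ((piContramodule hS).act (ev k f) p : ∀ x, M.obj.obj x) z = 0 :=
  piContraaction_ev_of_ne f h p

/-- The component of `piContramodule` at an object `x` is `M(x)`. -/
def piContramoduleComponent (x : E) : (piContramodule hS).component x ≃ₗ[k] M.obj.obj x := by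
  classical
  refine LinearEquiv.ofBijective ((LinearMap.proj x : (∀ x, M.obj.obj x) →ₗ[k] M.obj.obj x) ∘ₗ
    ((piContramodule hS).component x).subtype) ⟨?_, ?_⟩
  · rw [injective_iff_map_eq_zero]
    rintro ⟨p, hp⟩ h0
    refine Subtype.ext (funext fun y => ?_)
    by_cases hxy : x = y
    · subst hxy
      exact h0
    · change p y = 0
      rw [← (piContramodule hS).act_id_of_mem_component hp]
      exact piContramodule_act_of_ne hS (𝟙 x) hxy p
  · intro m
    refine ⟨⟨(piContramodule hS).act (ev k (𝟙 x)) (Pi.single x m : ∀ x, M.obj.obj x), ⟨_, rfl⟩⟩, ?_⟩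
    refine (piContramodule_act hS (𝟙 x) _).trans ?_
    simp

/-- The left module underlying `piContramodule` is isomorphic to the original left module. -/
def thetaPiContramoduleIso : theta (piContramodule hS) ≅ M :=
  ObjectProperty.isoMk _ (NatIso.ofComponents
    (fun x => (piContramoduleComponent hS x).toModuleIso) fun {x y} f => by
      ext p
      exact piContramodule_act hS f p.1)

end Construct

/-! ### Characterization of the class and closure under extensions -/

section Characterization

variable (k : Type uk) (E : Type u) [Field k] [Category.{v} E] [Preadditive E] [Linear k E]

variable {k E} in
/-- A left module in which, for every object `y`, all the morphisms `x ⟶ y` act by zero for almost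
all objects `x`. -/
def HasFiniteSources (M : LeftMod.{uk, u, v, w} k E) : Prop :=
  ∀ y : E, ∃ S : Set E, S.Finite ∧ ∀ x ∉ S, ∀ f : x ⟶ y, M.obj.map f = 0

/-- One direction is the vanishing of residues, transported along the isomorphism; the other is
`piContramodule`. The universe `max u w` leaves room for the product over all objects. -/
lemma isThetaOfLocallyFinite_iff [IsLeftStrictlyLocallyFinite k E]
    (M : LeftMod.{uk, u, v, max u w} k E) : isThetaOfLocallyFinite.{uk, u, v, max u w} k E M ↔
      isLocallyFiniteModule k E M ∧ HasFiniteSources M := by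
  constructor
  · rintro ⟨P, hP, ⟨e⟩⟩
    have e' : ∀ x, (theta P).obj.obj x ≅ M.obj.obj x := fun x =>
      ((isLeftModule k E).ι.mapIso e).app x
    refine ⟨fun x => ?_, fun y => ?_⟩
    · have : FiniteDimensional k ((theta P).obj.obj x) := hP x
      exact Module.Finite.equiv (e' x).toLinearEquiv
    · obtain ⟨S, hS, h⟩ := P.exists_finite_act_eq_zero hP y
      refine ⟨S, hS, fun x hx f => ?_⟩
      have h0 : (theta P).obj.map f = 0 := by
        ext p
        exact Subtype.ext (h x hx f p.1)
      have hn := ((isLeftModule k E).ι.mapIso e).inv.naturality f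
      have hn' : M.obj.map f ≫ e.inv.hom.app y = e.inv.hom.app x ≫ (theta P).obj.map f := hn
      rw [h0, Limits.comp_zero] at hn'
      have : IsIso (e.inv.hom.app y) :=
        inferInstanceAs (IsIso (((isLeftModule k E).ι.mapIso e).symm.app y).hom)
      exact (cancel_mono (e.inv.hom.app y)).1 (hn'.trans Limits.zero_comp.symm)
  · rintro ⟨hM, hM'⟩
    choose S hS h using hM'
    have h' : ∀ y, ∀ x ∉ (hS y).toFinset, ∀ f : x ⟶ y, M.obj.map f = 0 := fun y x hx f =>
      h y x (by simpa using hx) f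
    refine ⟨piContramodule h', fun x => ?_, ⟨thetaPiContramoduleIso h'⟩⟩
    have : FiniteDimensional k (M.obj.obj x) := hM x
    exact Module.Finite.equiv (piContramoduleComponent h' x).symm

variable {k E}

lemma map_apply_eq_zero_of_factorsThrough (M : LeftMod.{uk, u, v, w} k E) {T : Set E} {x y : E}
    (m : M.obj.obj x) (h : ∀ t ∈ T, ∀ (a : x ⟶ t) (b : t ⟶ y),
      (M.obj.map b).hom ((M.obj.map a).hom m) = 0) {f : x ⟶ y}
    (hf : f ∈ factorsThrough k T x y) : (M.obj.map f).hom m = 0 := by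
  have := M.property.1
  have := M.property.2
  induction hf using Submodule.span_induction with
  | mem f hf =>
    obtain ⟨t, ht, a, b, rfl⟩ := hf
    rw [M.obj.map_comp]
    exact h t ht a b
  | zero => simp
  | add a b _ _ ha hb =>
    rw [M.obj.map_add, ModuleCat.hom_add, LinearMap.add_apply, ha, hb, add_zero]
  | smul r a _ ha => rw [M.obj.map_smul, ModuleCat.hom_smul, LinearMap.smul_apply, ha, smul_zero]

/-- A left module that is an extension of two modules with finite sources has finite sources. -/
lemma HasFiniteSources.of_exact [IsLeftStrictlyLocallyFinite k E]
    {M' M M'' : LeftMod.{uk, u, v, w} k E} (i : M'.obj ⟶ M.obj) (p : M.obj ⟶ M''.obj)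
    (hex : ∀ x (m : M.obj.obj x), (p.app x).hom m = 0 → ∃ m', (i.app x).hom m' = m)
    (h' : HasFiniteSources M') (h'' : HasFiniteSources M'') : HasFiniteSources M := by
  intro y
  obtain ⟨S, hS, hz'⟩ := h' y
  obtain ⟨T, R, hT, hR, hTS, hfac⟩ := exists_factorsThrough_disjoint k hS y
  choose S'' hS'' hz'' using h''
  -- Avoiding `R` lets $f$ factor through `T`; avoiding `S'' t` makes every $x\to t$ act by zero on
  -- the quotient module.
  refine ⟨R ∪ ⋃ t ∈ T, S'' t, hR.union (hT.biUnion fun t _ => hS'' t), fun x hx f => ?_⟩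
  refine ModuleCat.hom_ext (LinearMap.ext fun m => ?_)
  refine map_apply_eq_zero_of_factorsThrough M m (fun t ht a b => ?_)
    (hfac x (fun h => hx (Or.inl h)) f)
  have hxt : x ∉ S'' t := fun h => hx (Or.inr (Set.mem_biUnion ht h))
  -- The image of $m$ under $a$ dies in $M''(t)$, so it comes from $M'(t)$, where $b$ acts by zero
  -- because $t\notin S$.
  obtain ⟨m', hm'⟩ := hex t ((M.obj.map a).hom m) (by
    have := congrArg (fun g => g.hom m) (p.naturality a)
    rw [hz'' t x hxt a] at this
    simpa using this)
  have := congrArg (fun g => g.hom m') (i.naturality b)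
  rw [hz' t (Set.disjoint_left.1 hTS ht) b] at this
  rw [← hm']
  simpa using this.symm

lemma isLocallyFiniteModule_of_exact {M' M M'' : LeftMod.{uk, u, v, w} k E}
    (i : M'.obj ⟶ M.obj) (p : M.obj ⟶ M''.obj)
    (hex : ∀ x (m : M.obj.obj x), (p.app x).hom m = 0 → ∃ m', (i.app x).hom m' = m)
    (h' : isLocallyFiniteModule k E M') (h'' : isLocallyFiniteModule k E M'') :
    isLocallyFiniteModule k E M := by
  intro x
  have : FiniteDimensional k (M'.obj.obj x) := h' x
  have : FiniteDimensional k (M''.obj.obj x) := h'' x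
  have hle : LinearMap.ker (p.app x).hom ≤ LinearMap.range (i.app x).hom := fun m hm => hex x m hm
  have : FiniteDimensional k (LinearMap.ker (p.app x).hom) := Submodule.finiteDimensional_of_le hle
  have : FiniteDimensional k (M.obj.obj x ⧸ LinearMap.ker (p.app x).hom) :=
    Module.Finite.equiv (p.app x).hom.quotKerEquivRange.symm
  exact Module.Finite.of_submodule_quotient (LinearMap.ker (p.app x).hom)

lemma isThetaOfLocallyFinite_of_exact [IsLeftStrictlyLocallyFinite k E]
    {M' M M'' : LeftMod.{uk, u, v, max u w} k E} (i : M'.obj ⟶ M.obj) (p : M.obj ⟶ M''.obj)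
    (hex : ∀ x (m : M.obj.obj x), (p.app x).hom m = 0 → ∃ m', (i.app x).hom m' = m)
    (h' : isThetaOfLocallyFinite.{uk, u, v, max u w} k E M')
    (h'' : isThetaOfLocallyFinite.{uk, u, v, max u w} k E M'') :
    isThetaOfLocallyFinite.{uk, u, v, max u w} k E M := by
  rw [isThetaOfLocallyFinite_iff] at h' h'' ⊢
  exact ⟨isLocallyFiniteModule_of_exact i p hex h'.1 h''.1,
    HasFiniteSources.of_exact i p hex h'.2 h''.2⟩

end Characterization

end LinCat

end

theorem mainTheorem7 (k : Type uk) (E : Type u) [Field k] [Category.{v} E] [Preadditive E]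
    [Linear k E] [LinCat.IsLeftStrictlyLocallyFinite k E] :
    (LinCat.isThetaOfLocallyFinite.{uk, u, v, max u w} k E).IsClosedUnderExtensions ∧
      ((LinCat.isThetaOfLocallyFinite.{uk, u, v, max u w} k E).inverseImage
        (LinCat.isLocallyFiniteModule.{uk, u, v, max u w} k E).ι).IsClosedUnderExtensions :=
  ⟨⟨fun {S} hS h₁ h₃ => LinCat.isThetaOfLocallyFinite_of_exact S.f.hom S.g.hom
      (LinCat.exists_preimage_of_exact (LinCat.leftMod_exact_map k E hS.exact)) h₁ h₃⟩,
    ⟨fun {S} hS h₁ h₃ => LinCat.isThetaOfLocallyFinite_of_exact S.f.hom.hom S.g.hom.hom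
      (LinCat.exists_preimage_of_exact (LinCat.locFinLeftMod_exact_map k E hS.exact)) h₁ h₃⟩⟩
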